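/- Theorem 2.1. Let $G$ be a Polish group. A Borel $G$-space is a standard Borel space $X$ with an action of $G$ such that $(g,x)\mapsto g\cdot x$ is a Borel map $G\times X\to X$. A Borel $G$-space $\mathcal U$ is universal if for every Borel $G$-space $X$ there is an injective Borel map $\pi\colon X\to\mathcal U$ with $\pi(g\cdot x)=g\cdot\pi(x)$ for all $g\in G$, $x\in X$. Let $\mathcal F(G)$ be the set of all closed subsets of $G$ with the Effros Borel structure, i.e. the $\sigma$-algebra generated by the sets $\{F\in\mathcal F(G): F\cap V\neq\emptyset\}$ for $V\subseteq G$ open, on which $G$ acts by left translation, $g\cdot F=\{gx: x\in F\}$. Then $\mathcal U_G=\mathcal F(G)^{\mathbb N}$, with the product $\sigma$-algebra and the coordinatewise action of $G$, is a universal Borel $G$-space. In particular, every Polish group has a universal Borel $G$-space. Moreover, $\mathcal U_G$ can be taken to be a Polish $G$-space: there is a Polish topology on $\mathcal F(G)^{\mathbb N}$ whose Borel $\sigma$-algebra is the given one and for which the action $G\times\mathcal F(G)^{\mathbb N}\to\mathcal F(G)^{\mathbb N}$ is continuous. -/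

import Mathlib

open scoped Pointwise

universe u v w

/-- The space `F(X)` of all closed subsets of `X` (the empty set included). It is a separate type
so that it carries the Effros Borel structure and nothing else (in particular no topology). -/
def EffrosSpace (X : Type u) [TopologicalSpace X] : Type u :=
  TopologicalSpace.Closeds X

namespace EffrosSpace

/-- The underlying subset of a point of `F(X)`. -/
def toSet {X : Type u} [TopologicalSpace X] (F : EffrosSpace X) : Set X :=
  TopologicalSpace.Closeds.carrier F

theorem isClosed_toSet {X : Type u} [TopologicalSpace X] (F : EffrosSpace X) :
    IsClosed F.toSet :=
  TopologicalSpace.Closeds.isClosed' F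

theorem ext {X : Type u} [TopologicalSpace X] {F F' : EffrosSpace X}
    (h : F.toSet = F'.toSet) : F = F' :=
  TopologicalSpace.Closeds.ext h

/-- The Effros Borel structure: the σ-algebra on `F(X)` generated by the sets
`{F | F ∩ V ≠ ∅}` with `V ⊆ X` open. -/
instance instMeasurableSpace (X : Type u) [TopologicalSpace X] :
    MeasurableSpace (EffrosSpace X) :=
  MeasurableSpace.generateFrom
    {A | ∃ V : Set X, IsOpen V ∧ A = {F : EffrosSpace X | (F.toSet ∩ V).Nonempty}}

/-- `G` acts on `F(G)` by left translation: `g • F = {g * x | x ∈ F}`. -/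
instance instMulAction (G : Type u) [Group G] [TopologicalSpace G] [IsTopologicalGroup G] :
    MulAction G (EffrosSpace G) where
  smul g F := (⟨g • F.toSet, F.isClosed_toSet.smul g⟩ : TopologicalSpace.Closeds G)
  one_smul F := EffrosSpace.ext (one_smul G F.toSet)
  mul_smul g h F := EffrosSpace.ext (mul_smul g h F.toSet)

theorem toSet_smul {G : Type u} [Group G] [TopologicalSpace G] [IsTopologicalGroup G]
    (g : G) (F : EffrosSpace G) : (g • F).toSet = (fun x => g * x) '' F.toSet :=
  rfl

end EffrosSpace

/-- `X`, with its σ-algebra and its action of the Polish group `G`, is a Borel `G`-space: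
`X` is a standard Borel space and `(g, x) ↦ g • x` is a Borel map `G × X → X`. -/
def IsBorelGSpace (G : Type u) [Group G] [MeasurableSpace G]
    (X : Type v) [MeasurableSpace X] [MulAction G X] : Prop :=
  StandardBorelSpace X ∧ Measurable (fun p : G × X => p.1 • p.2)

/-- A Borel embedding of `G`-spaces: an equivariant Borel injection. -/
def IsBorelGEmbedding (G : Type u) [Group G]
    {X : Type v} [MeasurableSpace X] [MulAction G X]
    {Y : Type w} [MeasurableSpace Y] [MulAction G Y] (π : X → Y) : Prop :=
  Measurable π ∧ Function.Injective π ∧ ∀ (g : G) (x : X), π (g • x) = g • π x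

/-- `U` is a universal Borel `G`-space: it is a Borel `G`-space, and every Borel `G`-space (in the
arbitrary universe `v`) Borel-embeds into it. -/
def IsUniversalBorelGSpace (G : Type u) [Group G] [MeasurableSpace G]
    (U : Type w) [MeasurableSpace U] [MulAction G U] : Prop :=
  IsBorelGSpace G U ∧
    ∀ (X : Type v) [MeasurableSpace X] [MulAction G X], IsBorelGSpace G X →
      ∃ π : X → U, IsBorelGEmbedding G π

/-- The topology `τ` makes `X` a Polish `G`-space: `τ` is Polish and `(g, x) ↦ g • x` is
continuous. -/
def IsPolishGSpace (G : Type u) [Group G] [TopologicalSpace G]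
    (X : Type v) [MulAction G X] (τ : TopologicalSpace X) : Prop :=
  PolishSpace X ∧ Continuous (fun p : G × X => p.1 • p.2)

/-! Topology: fix a left-invariant compatible metric `d` on `G` and a dense sequence `x n`, and
record a closed `F` by its distances `d (x n, F)`, with value `∞` for the empty set. The induced
topology generates the Effros structure (`eq_comap_distSeq`). It is Polish because the range is Gδ
(`isGδ_range_distSeq`). Since `d` need not be complete, this uses a second, complete metric. The
action is continuous since `d (z, g • F) = d (g⁻¹ * z, F)` is jointly continuous in `g` and `F`.

Universality: choose Borel sets `A n` separating points of `X`, and send `x` to the closed sets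
where `{g | g⁻¹ • x ∈ A n}` is locally nonmeagre. Such a closed set determines a set with the Baire
property modulo meagre sets, so if `x` and `y` have equal images then, for some `g`, no `A n`
separates `g⁻¹ • x` from `g⁻¹ • y`, whence `x = y`. -/

section Wijsman

open Set Filter Metric
open scoped ENNReal Topology

/-! ### The Polish topology on closed sets given by distance functions. -/

theorem IsGδ.polishSpace {α : Type*} [TopologicalSpace α] [PolishSpace α] {s : Set α}
    (hs : IsGδ s) : PolishSpace s := by
  obtain ⟨U, hU, rfl⟩ := isGδ_iff_eq_iInter_nat.1 hs
  have (n : ℕ) : PolishSpace (U n) := (hU n).polishSpace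
  let f : (⋂ n, U n : Set α) → (n : ℕ) → U n := fun x n => ⟨x.1, mem_iInter.1 x.2 n⟩
  have hf : Continuous f := by fun_prop
  have hr : range f = {y | ∀ n, (y n).1 = (y 0).1} := by
    ext y
    constructor
    · rintro ⟨x, rfl⟩ n
      rfl
    · intro hy
      refine ⟨⟨(y 0).1, mem_iInter.2 fun n => hy n ▸ (y n).2⟩, ?_⟩
      funext n
      exact Subtype.ext (hy n).symm
  have he : Topology.IsEmbedding f := by
    have h0 : Continuous fun y : (n : ℕ) → U n => (y 0).1 := by fun_prop
    exact .of_comp hf h0 .subtypeVal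
  refine Topology.IsClosedEmbedding.polishSpace (f := f) ⟨he, ?_⟩
  rw [hr, ofPred_forall]
  exact isClosed_iInter fun n => isClosed_eq (by fun_prop) (by fun_prop)

theorem exists_leftInvariant_pseudoEMetricSpace (G : Type*) [Group G] [t : TopologicalSpace G]
    [IsTopologicalGroup G] [FirstCountableTopology G] :
    ∃ m : PseudoEMetricSpace G, m.toUniformSpace.toTopologicalSpace = t ∧
      ∀ g x y : G, edist (g * x) (g * y) = edist x y := by
  let : UniformSpace G := IsTopologicalGroup.leftUniformSpace G
  have : (uniformity G).IsCountablyGenerated :=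
    Filter.comap.isCountablyGenerated (𝓝 (1 : G)) _
  let p : PseudoMetricSpace G := UniformSpace.pseudoMetricSpace G
  -- The supremum forces invariance. It stays compatible because the entourages `y⁻¹ * x ∈ V` of the
  -- left uniformity are themselves left-invariant.
  let δ : G → G → ℝ≥0∞ := fun x y => ⨆ g : G, edist (g * x) (g * y)
  have hle (x y : G) : edist x y ≤ δ x y := by
    simpa using le_iSup (fun g : G => edist (g * x) (g * y)) 1
  have hδ (g x y : G) : δ (g * x) (g * y) = δ x y := by
    simp only [δ, ← mul_assoc]
    exact (Equiv.mulRight g).iSup_comp (g := fun h : G => edist (h * x) (h * y))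
  have hnhds (x : G) : (𝓝 x).HasBasis (fun ε : ℝ≥0∞ => 0 < ε) fun ε => {y | δ y x < ε} := by
    refine ⟨fun t => nhds_basis_eball.mem_iff.trans ⟨?_, ?_⟩⟩
    · rintro ⟨ε, hε, ht⟩
      exact ⟨ε, hε, fun y hy => ht ((hle y x).trans_lt hy)⟩
    · rintro ⟨ε, hε, ht⟩
      obtain ⟨r, hr, hrε⟩ := exists_between hε
      have hu : {q : G × G | edist q.1 q.2 < r} ∈ uniformity G := edist_mem_uniformity hr
      obtain ⟨V, hV, hVs⟩ := hu
      have hy : ∀ᶠ y in 𝓝 x, y⁻¹ * x ∈ V := by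
        have : Tendsto (fun y : G => y⁻¹ * x) (𝓝 x) (𝓝 (x⁻¹ * x)) :=
          (continuous_inv.mul continuous_const).tendsto x
        rw [inv_mul_cancel] at this
        exact this hV
      refine nhds_basis_eball.mem_iff.1 (mem_of_superset hy fun y hy => ht ?_)
      refine lt_of_le_of_lt (iSup_le fun g => ?_) hrε
      have hg : (g * y)⁻¹ * (g * x) ∈ V := by simpa [mul_assoc] using hy
      exact le_of_lt (@hVs (g * y, g * x) hg)
  let m : PseudoEMetricSpace G :=
    { edist := δ
      edist_self := fun x => by simp [δ]
      edist_comm := fun x y => by simp only [δ, edist_comm]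
      edist_triangle := fun x y z => iSup_le fun g =>
        (edist_triangle _ (g * y) _).trans (add_le_add
          (le_iSup (fun g : G => edist (g * x) (g * y)) g)
          (le_iSup (fun g : G => edist (g * y) (g * z)) g)) }
  exact ⟨m, TopologicalSpace.ext_nhds fun x =>
    (@nhds_basis_eball G m x).eq_of_same_basis (hnhds x), hδ⟩

namespace EffrosSpace

section PseudoEMetric

variable {X : Type u} [PseudoEMetricSpace X]

/-- The distances of the points of a sequence from a closed set. -/
noncomputable def distSeq (x : ℕ → X) (F : EffrosSpace X) : ℕ → ℝ≥0∞ :=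
  fun n => infEDist (x n) F.toSet

variable {x : ℕ → X}

theorem infEDist_eq_iInf_distSeq (hx : DenseRange x) (z : X) (F : EffrosSpace X) :
    infEDist z F.toSet = ⨅ n, edist z (x n) + F.distSeq x n := by
  refine le_antisymm (le_iInf fun n => infEDist_le_edist_add_infEDist) ?_
  refine le_of_forall_gt fun r hr => ?_
  obtain ⟨ε, hε, hεr⟩ := ENNReal.lt_iff_exists_add_pos_lt.1 hr
  have hε' : (0 : ℝ≥0∞) < ε / 2 := ENNReal.half_pos (by exact_mod_cast hε.ne')
  obtain ⟨n, hn⟩ := hx.exists_mem_open isOpen_eball ⟨z, mem_eball_self hε'⟩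
  refine lt_of_le_of_lt (iInf_le _ n) (lt_of_le_of_lt ?_ hεr)
  have h1 : edist z (x n) ≤ ε / 2 := (mem_eball'.1 hn).le
  calc edist z (x n) + F.distSeq x n
      ≤ ε / 2 + (infEDist z F.toSet + ε / 2) := by
        refine add_le_add h1 ((infEDist_le_infEDist_add_edist (y := z)).trans ?_)
        exact add_le_add le_rfl (edist_comm (x n) z ▸ h1)
    _ = infEDist z F.toSet + ε := by
        rw [add_left_comm, ENNReal.add_halves]

theorem distSeq_injective (hx : DenseRange x) : Function.Injective (distSeq x) := by
  intro F F' h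
  refine EffrosSpace.ext (Set.ext fun z => ?_)
  rw [mem_iff_infEDist_zero_of_closed F.isClosed_toSet,
    mem_iff_infEDist_zero_of_closed F'.isClosed_toSet, infEDist_eq_iInf_distSeq hx,
    infEDist_eq_iInf_distSeq hx, h]

theorem infEDist_lt_iff_inter_eball_nonempty {z : X} {s : Set X} {r : ℝ≥0∞} :
    infEDist z s < r ↔ (s ∩ eball z r).Nonempty := by
  simp only [infEDist_lt_iff, Set.Nonempty, mem_inter_iff, mem_eball']

theorem measurableSet_inter_nonempty {V : Set X} (hV : IsOpen V) :
    MeasurableSet {F : EffrosSpace X | (F.toSet ∩ V).Nonempty} :=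
  MeasurableSpace.measurableSet_generateFrom ⟨V, hV, rfl⟩

theorem measurable_distSeq (x : ℕ → X) : Measurable (distSeq x) := by
  refine measurable_pi_iff.2 fun n => measurable_of_Iio fun r => ?_
  have : (fun F : EffrosSpace X => F.distSeq x n) ⁻¹' Iio r =
      {F : EffrosSpace X | (F.toSet ∩ eball (x n) r).Nonempty} := by
    ext F
    exact infEDist_lt_iff_inter_eball_nonempty
  rw [this]
  exact measurableSet_inter_nonempty isOpen_eball

theorem setOf_inter_nonempty_eq (hx : DenseRange x) {V : Set X} (hV : IsOpen V) :
    {F : EffrosSpace X | (F.toSet ∩ V).Nonempty} =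
      distSeq x ⁻¹' ⋃ n, ⋃ r, ⋃ _ : eball (x n) r ⊆ V, {f | f n < r} := by
  ext F
  simp only [mem_ofPred_eq, mem_preimage, mem_iUnion, exists_prop]
  constructor
  · rintro ⟨z, hzF, hzV⟩
    obtain ⟨ε, hε, hεV⟩ := EMetric.isOpen_iff.1 hV z hzV
    have hε' : 0 < ε / 2 := ENNReal.half_pos hε.ne'
    obtain ⟨n, hn⟩ := hx.exists_mem_open isOpen_eball ⟨z, mem_eball_self hε'⟩
    refine ⟨n, ε / 2, fun y hy => hεV ?_, infEDist_lt_iff.2 ⟨z, hzF, hn⟩⟩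
    calc edist y z ≤ edist y (x n) + edist (x n) z := edist_triangle _ _ _
      _ < ε / 2 + ε / 2 := ENNReal.add_lt_add hy hn
      _ = ε := ENNReal.add_halves ε
  · rintro ⟨n, r, hr, h⟩
    exact (infEDist_lt_iff_inter_eball_nonempty.1 h).mono (inter_subset_inter_right _ hr)

/-- The union over `r` is uncountable, so measurability has to come from openness. -/
theorem isOpen_iUnion_setOf_lt (V : Set X) (x : ℕ → X) :
    IsOpen (⋃ n, ⋃ r, ⋃ _ : eball (x n) r ⊆ V, {f : ℕ → ℝ≥0∞ | f n < r}) :=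
  isOpen_iUnion fun n => isOpen_iUnion fun _ => isOpen_iUnion fun _ =>
    isOpen_lt (continuous_apply n) continuous_const

theorem eq_comap_distSeq (hx : DenseRange x) :
    instMeasurableSpace X = MeasurableSpace.comap (distSeq x) MeasurableSpace.pi := by
  refine le_antisymm (MeasurableSpace.generateFrom_le ?_) (measurable_distSeq x).comap_le
  rintro _ ⟨V, hV, rfl⟩
  exact ⟨_, (isOpen_iUnion_setOf_lt V x).measurableSet, (setOf_inter_nonempty_eq hx hV).symm⟩

theorem continuous_infEDist_uncurry [TopologicalSpace (EffrosSpace X)] (hx : DenseRange x)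
    (hc : Continuous (distSeq x)) :
    Continuous fun p : X × EffrosSpace X => infEDist p.1 p.2.toSet := by
  have hn (n : ℕ) : Continuous fun p : X × EffrosSpace X => p.2.distSeq x n :=
    (continuous_apply n).comp (hc.comp continuous_snd)
  have he (n : ℕ) : Continuous fun p : X × EffrosSpace X => edist p.1 (x n) := by fun_prop
  refine OrderTopology.continuous_iff.2 fun r => ⟨?_, ?_⟩
  -- Distances may be `∞`, so the Lipschitz estimate is kept in additive form, without subtraction.
  · have : (fun p : X × EffrosSpace X => infEDist p.1 p.2.toSet) ⁻¹' Ioi r =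
        ⋃ n, ⋃ s, {p | edist p.1 (x n) < s} ∩ {p | r + s < p.2.distSeq x n} := by
      ext ⟨z, F⟩
      simp only [mem_preimage, mem_Ioi, mem_iUnion, mem_inter_iff, mem_ofPred_eq]
      constructor
      · intro h
        obtain ⟨ε, hε, hεr⟩ := ENNReal.lt_iff_exists_add_pos_lt.1 h
        have hε' : (0 : ℝ≥0∞) < ε / 2 := ENNReal.half_pos (by exact_mod_cast hε.ne')
        obtain ⟨n, hn⟩ := hx.exists_mem_open isOpen_eball ⟨z, mem_eball_self hε'⟩
        refine ⟨n, ε / 2, mem_eball'.1 hn, ?_⟩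
        have h1 : infEDist z F.toSet ≤ ε / 2 + F.distSeq x n :=
          infEDist_le_edist_add_infEDist.trans (add_le_add (mem_eball'.1 hn).le le_rfl)
        have h2 := hεr.trans_le h1
        nth_rewrite 1 [← ENNReal.add_halves (ε : ℝ≥0∞)] at h2
        rw [← add_assoc, add_comm] at h2
        exact lt_of_add_lt_add_left h2
      · rintro ⟨n, s, h1, h2⟩
        by_contra! h
        refine absurd h2 (not_lt.2 ?_)
        calc F.distSeq x n ≤ infEDist z F.toSet + edist (x n) z := infEDist_le_infEDist_add_edist
          _ ≤ r + s := by rw [edist_comm]; gcongr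
    rw [this]
    exact isOpen_iUnion fun n => isOpen_iUnion fun s =>
      (isOpen_lt (he n) continuous_const).inter (isOpen_lt continuous_const (hn n))
  · have : (fun p : X × EffrosSpace X => infEDist p.1 p.2.toSet) ⁻¹' Iio r =
        ⋃ n, {p | edist p.1 (x n) + p.2.distSeq x n < r} := by
      ext ⟨z, F⟩
      simp only [mem_preimage, mem_Iio, infEDist_eq_iInf_distSeq hx, iInf_lt_iff, mem_iUnion,
        mem_ofPred_eq]
    rw [this]
    exact isOpen_iUnion fun n => isOpen_lt ((he n).add (hn n)) continuous_const

/-- The balls around points of `x` that are small with respect to `d` and, through `e`, with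
respect to the metric of `Y`, and that are well inside a given ball. -/
def IsSmallBall {Y : Type*} [PseudoEMetricSpace Y] (e : X → Y) (x : ℕ → X) (n : ℕ) (q : ℝ≥0∞)
    (k m : ℕ) (s : ℝ≥0∞) : Prop :=
  closedEBall (x m) s ⊆ eball (x n) q ∧ s ≤ (k : ℝ≥0∞)⁻¹ ∧
    ∀ a ∈ closedEBall (x m) s, ∀ b ∈ closedEBall (x m) s, edist (e a) (e b) ≤ (k : ℝ≥0∞)⁻¹

theorem exists_isSmallBall {Y : Type*} [PseudoEMetricSpace Y] {e : X → Y} (he : Continuous e)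
    (hx : DenseRange x) {Q : Set ℝ≥0∞} (hQ : Dense Q) {F : EffrosSpace X} {n : ℕ} {q : ℝ≥0∞}
    (h : F.distSeq x n < q) (k : ℕ) :
    ∃ m, ∃ s ∈ Q, IsSmallBall e x n q k m s ∧ F.distSeq x m < s := by
  obtain ⟨z, hzF, hz⟩ := infEDist_lt_iff.1 h
  have hk : (0 : ℝ≥0∞) < (k : ℝ≥0∞)⁻¹ := ENNReal.inv_pos.2 (ENNReal.natCast_ne_top k)
  have hk' : (0 : ℝ≥0∞) < (k : ℝ≥0∞)⁻¹ / 2 := ENNReal.half_pos hk.ne'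
  have hO : eball (x n) q ∩ e ⁻¹' eball (e z) ((k : ℝ≥0∞)⁻¹ / 2) ∈ 𝓝 z :=
    inter_mem (isOpen_eball.mem_nhds (mem_eball'.2 hz))
      (he.continuousAt.preimage_mem_nhds (eball_mem_nhds _ hk'))
  obtain ⟨ε, hε, hεO⟩ := EMetric.mem_nhds_iff.1 hO
  obtain ⟨s, hsQ, hs0, hs⟩ := hQ.exists_between (lt_min (ENNReal.half_pos hε.ne') hk)
  obtain ⟨m, hm⟩ := hx.exists_mem_open isOpen_eball ⟨z, mem_eball_self hs0⟩
  have hsub : closedEBall (x m) s ⊆ eball z ε := fun y hy =>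
    calc edist y z ≤ edist y (x m) + edist (x m) z := edist_triangle _ _ _
      _ ≤ s + s := add_le_add hy hm.le
      _ < ε / 2 + ε / 2 := by
        have := hs.trans_le (min_le_left _ _)
        exact ENNReal.add_lt_add this this
      _ = ε := ENNReal.add_halves ε
  refine ⟨m, s, hsQ, ⟨fun y hy => (hεO (hsub hy)).1, (hs.trans_le (min_le_right _ _)).le,
    fun a ha b hb => ?_⟩, infEDist_lt_iff.2 ⟨z, hzF, hm⟩⟩
  calc edist (e a) (e b) ≤ edist (e a) (e z) + edist (e b) (e z) := edist_triangle_right _ _ _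
    _ ≤ (k : ℝ≥0∞)⁻¹ / 2 + (k : ℝ≥0∞)⁻¹ / 2 :=
      add_le_add (le_of_lt (hεO (hsub ha)).2) (le_of_lt (hεO (hsub hb)).2)
    _ = (k : ℝ≥0∞)⁻¹ := ENNReal.add_halves _

/-- Small balls can be nested repeatedly. Their centres are Cauchy in the complete space `Y`, and
the limit is a point of the closed set that `f` should describe. -/
theorem exists_edist_lt_of_isSmallBall {Y : Type*} [PseudoEMetricSpace Y] [CompleteSpace Y]
    (e : X ≃ₜ Y) {Q : Set ℝ≥0∞} {f : ℕ → ℝ≥0∞} (hf : ∀ i j, f i ≤ f j + edist (x i) (x j))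
    (h : ∀ n, ∀ q ∈ Q, ∀ k, q ≤ f n ∨ ∃ m, ∃ s ∈ Q, IsSmallBall e x n q k m s ∧ f m < s)
    {n : ℕ} {q : ℝ≥0∞} (hq : q ∈ Q) (hnq : f n < q) :
    ∃ z, edist (x n) z < q ∧ ∀ j, f j ≤ edist (x j) z := by
  have step (k : ℕ) (b : {b : ℕ × ℝ≥0∞ // b.2 ∈ Q ∧ f b.1 < b.2}) :
      ∃ b' : {b : ℕ × ℝ≥0∞ // b.2 ∈ Q ∧ f b.1 < b.2},
        IsSmallBall e x b.1.1 b.1.2 k b'.1.1 b'.1.2 := by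
    obtain ⟨m, s, hs, hsm, hm⟩ := (h b.1.1 b.1.2 b.2.1 k).resolve_left (not_le.2 b.2.2)
    exact ⟨⟨(m, s), hs, hm⟩, hsm⟩
  choose next hnext using step
  let B : ℕ → {b : ℕ × ℝ≥0∞ // b.2 ∈ Q ∧ f b.1 < b.2} :=
    fun k => Nat.rec ⟨(n, q), hq, hnq⟩ next k
  have hB (k : ℕ) : IsSmallBall e x (B k).1.1 (B k).1.2 k (B (k + 1)).1.1 (B (k + 1)).1.2 :=
    hnext k (B k)
  let C : ℕ → Set X := fun k => closedEBall (x (B k).1.1) (B k).1.2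
  have hC : Antitone C := antitone_nat_of_succ_le fun k =>
    (hB k).1.trans eball_subset_closedEBall
  let c : ℕ → X := fun k => x (B k).1.1
  have hc {k l : ℕ} (hkl : k ≤ l) : c l ∈ C k := hC hkl mem_closedEBall_self
  -- The shift by one appears because `C (k + 1)` is the ball with tolerance `k⁻¹`; for `k = 0` this
  -- is `∞`, which is no constraint.
  have hcauchy : CauchySeq fun k => e (c (k + 1)) := by
    refine EMetric.cauchySeq_iff_le_tendsto_0.2
      ⟨fun k => (k : ℝ≥0∞)⁻¹, fun i j k hi hj => ?_, ENNReal.tendsto_inv_nat_nhds_zero⟩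
    exact (hB k).2.2 _ (hc (Nat.succ_le_succ hi)) _ (hc (Nat.succ_le_succ hj))
  obtain ⟨y, hy⟩ := cauchySeq_tendsto_of_complete hcauchy
  have hz : Tendsto (fun k => c (k + 1)) atTop (𝓝 (e.symm y)) := by
    simpa [Function.comp_def] using (e.symm.continuous.tendsto y).comp hy
  have hzC (k : ℕ) : e.symm y ∈ C k :=
    isClosed_closedEBall.mem_of_tendsto hz
      ((eventually_ge_atTop k).mono fun l hl => hc (hl.trans l.le_succ))
  refine ⟨e.symm y, mem_eball'.1 ((hB 0).1 (hzC 1)), fun j => ?_⟩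
  have hlim : Tendsto (fun k : ℕ => edist (x j) (e.symm y) + ((k : ℝ≥0∞)⁻¹ + (k : ℝ≥0∞)⁻¹)) atTop
      (𝓝 (edist (x j) (e.symm y) + (0 + 0))) :=
    tendsto_const_nhds.add (ENNReal.tendsto_inv_nat_nhds_zero.add ENNReal.tendsto_inv_nat_nhds_zero)
  rw [add_zero, add_zero] at hlim
  refine ge_of_tendsto' hlim fun k => ?_
  have hs : (B (k + 1)).1.2 ≤ (k : ℝ≥0∞)⁻¹ := (hB k).2.1
  calc f j ≤ f (B (k + 1)).1.1 + edist (x j) (c (k + 1)) := hf _ _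
    _ ≤ (k : ℝ≥0∞)⁻¹ + (edist (x j) (e.symm y) + (k : ℝ≥0∞)⁻¹) := by
      refine add_le_add ((B (k + 1)).2.2.le.trans hs) ((edist_triangle _ (e.symm y) _).trans ?_)
      exact add_le_add le_rfl (le_trans (hzC (k + 1)) hs)
    _ = _ := by rw [add_left_comm]

/-- With `Q` countable, the second condition is a countable intersection of unions of a closed and
an open set, hence Gδ. -/
theorem range_distSeq {Y : Type*} [PseudoEMetricSpace Y] [CompleteSpace Y] (e : X ≃ₜ Y)
    (hx : DenseRange x) {Q : Set ℝ≥0∞} (hQ : Dense Q) :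
    range (distSeq x) = {f | ∀ i j, f i ≤ f j + edist (x i) (x j)} ∩
      {f | ∀ n, ∀ q ∈ Q, ∀ k, q ≤ f n ∨ ∃ m, ∃ s ∈ Q, IsSmallBall e x n q k m s ∧ f m < s} := by
  ext f
  constructor
  · rintro ⟨F, rfl⟩
    refine ⟨fun i j => infEDist_le_infEDist_add_edist, fun n q _ k => ?_⟩
    exact (le_or_gt q _).imp_right fun h => exists_isSmallBall e.continuous hx hQ h k
  · rintro ⟨hf, h⟩
    have hcl : IsClosed {z | ∀ j, f j ≤ edist (x j) z} := by
      rw [ofPred_forall]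
      exact isClosed_iInter fun j => isClosed_le continuous_const (by fun_prop)
    refine ⟨(⟨_, hcl⟩ : TopologicalSpace.Closeds X), funext fun n => le_antisymm ?_ ?_⟩
    · refine le_of_forall_gt fun r hr => ?_
      obtain ⟨q, hq, hnq, hqr⟩ := hQ.exists_between hr
      obtain ⟨z, hz, hzF⟩ := exists_edist_lt_of_isSmallBall e hf h hq hnq
      exact infEDist_lt_iff.2 ⟨z, hzF, hz.trans hqr⟩
    · exact le_infEDist.2 fun z hz => hz n

theorem isGδ_range_distSeq {Y : Type*} [PseudoEMetricSpace Y] [CompleteSpace Y] (e : X ≃ₜ Y)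
    (hx : DenseRange x) : IsGδ (range (distSeq x)) := by
  obtain ⟨Q, hQc, hQ⟩ := TopologicalSpace.exists_countable_dense ℝ≥0∞
  rw [range_distSeq e hx hQ]
  refine .inter (IsClosed.isGδ ?_) ?_
  · simp only [ofPred_forall]
    exact isClosed_iInter fun i => isClosed_iInter fun j =>
      isClosed_le (continuous_apply i) ((continuous_apply j).add continuous_const)
  · simp only [ofPred_forall]
    refine .iInter fun n => .biInter hQc fun q _ => .iInter fun k => ?_
    rw [ofPred_or]
    refine .union (isClosed_le continuous_const (continuous_apply n)).isGδ (IsOpen.isGδ ?_)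
    simp only [ofPred_exists, ofPred_and]
    exact isOpen_iUnion fun m => isOpen_iUnion fun s => isOpen_const.inter
      (isOpen_const.inter (isOpen_lt (continuous_apply m) continuous_const))

theorem polishSpace_induced_distSeq {Y : Type*} [PseudoEMetricSpace Y] [CompleteSpace Y]
    (e : X ≃ₜ Y) (hx : DenseRange x) :
    @PolishSpace (EffrosSpace X) (.induced (distSeq x) inferInstance) := by
  let : TopologicalSpace (EffrosSpace X) := .induced (distSeq x) inferInstance
  have := (isGδ_range_distSeq e hx).polishSpace
  have he : Topology.IsEmbedding (distSeq x) := ⟨⟨rfl⟩, distSeq_injective hx⟩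
  exact he.toHomeomorph.isClosedEmbedding.polishSpace

theorem borelSpace_induced_distSeq (hx : DenseRange x) :
    @BorelSpace (EffrosSpace X) (.induced (distSeq x) inferInstance) _ := by
  let : TopologicalSpace (EffrosSpace X) := .induced (distSeq x) inferInstance
  refine ⟨(eq_comap_distSeq hx).trans ?_⟩
  rw [borel_comap, ← BorelSpace.measurable_eq]

end PseudoEMetric

theorem exists_isPolishGSpace (G : Type u) [Group G] [t : TopologicalSpace G]
    [IsTopologicalGroup G] [PolishSpace G] : ∃ τ : TopologicalSpace (EffrosSpace G),
      BorelSpace (EffrosSpace G) ∧ IsPolishGSpace G (EffrosSpace G) τ := by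
  -- The complete metric lives on a separate `Y`, as `G` itself will carry the invariant one.
  obtain ⟨Y, _, _, ⟨e⟩⟩ : ∃ (Y : Type u) (_ : PseudoEMetricSpace Y),
      CompleteSpace Y ∧ Nonempty (G ≃ₜ Y) := by
    let := TopologicalSpace.upgradeIsCompletelyMetrizable G
    exact ⟨G, inferInstance, inferInstance, ⟨.refl G⟩⟩
  obtain ⟨m, rfl, hinv⟩ := exists_leftInvariant_pseudoEMetricSpace G
  have hx := TopologicalSpace.denseRange_denseSeq G
  let τ : TopologicalSpace (EffrosSpace G) :=
    .induced (distSeq (TopologicalSpace.denseSeq G)) inferInstance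
  refine ⟨τ, borelSpace_induced_distSeq hx, polishSpace_induced_distSeq e hx, ?_⟩
  refine continuous_induced_rng.2 (continuous_pi fun n => ?_)
  have : IsIsometricSMul G G := ⟨fun g x y => hinv g x y⟩
  have hd (p : G × EffrosSpace G) : distSeq (TopologicalSpace.denseSeq G) (p.1 • p.2) n =
      infEDist (p.1⁻¹ * TopologicalSpace.denseSeq G n) p.2.toSet := by
    rw [← infEDist_smul p.1, smul_eq_mul, mul_inv_cancel_left]
    rfl
  simp only [Function.comp_apply, hd]
  exact (continuous_infEDist_uncurry hx continuous_induced_dom).comp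
    ((continuous_fst.inv.mul continuous_const).prodMk continuous_snd)

end EffrosSpace

end Wijsman

/-! ### Baire category: measurability of the category quantifier and locally nonmeagre points. -/

section Category

open Set Filter Topology TopologicalSpace

theorem isMeagre_diff_of_residualEq {α : Type*} [TopologicalSpace α] {s t : Set α}
    (h : s =ᵇ t) : IsMeagre (s \ t) := by
  filter_upwards [eventuallyEq_set.1 h] with x hx
  simp [hx]

theorem BaireMeasurableSet.exists_basis_isMeagre_diff {α : Type*} [TopologicalSpace α]
    [SecondCountableTopology α] {A V : Set α} (hA : BaireMeasurableSet A)
    (hV : IsOpen V) (h : ¬ IsMeagre (A ∩ V)) :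
    ∃ b ∈ countableBasis α, b ⊆ V ∧ IsMeagre (b \ A) := by
  obtain ⟨U, hU, hAU⟩ := hA.residualEq_isOpen
  have hne : (U ∩ V).Nonempty := by
    by_contra! hne
    refine h ((isMeagre_diff_of_residualEq hAU).mono fun z hz => ?_)
    refine ⟨hz.1, fun hzU => ?_⟩
    exact notMem_empty z (hne.subset ⟨hzU, hz.2⟩)
  obtain ⟨z, hz⟩ := hne
  obtain ⟨b, hb, -, hbU⟩ :=
    (isBasis_countableBasis α).exists_subset_of_mem_open hz (hU.inter hV)
  exact ⟨b, hb, hbU.trans inter_subset_right,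
    (isMeagre_diff_of_residualEq hAU.symm).mono (sdiff_subset_sdiff_left (hbU.trans inter_subset_left))⟩

/-- Turns a complement into a countable quantifier, which is what an induction over the product
σ-algebra needs. -/
theorem BaireMeasurableSet.isMeagre_compl_inter_iff {α : Type*} [TopologicalSpace α]
    [SecondCountableTopology α] [BaireSpace α] {A V : Set α} (hA : BaireMeasurableSet A)
    (hV : IsOpen V) :
    IsMeagre (Aᶜ ∩ V) ↔ ∀ b ∈ countableBasis α, b ⊆ V → ¬ IsMeagre (A ∩ b) := by
  constructor
  · intro h b hb hbV hAb
    refine not_isMeagre_of_isOpen (isOpen_of_mem_countableBasis hb)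
      (nonempty_of_mem_countableBasis hb) ((h.union hAb).mono fun z hz => ?_)
    exact (em (z ∈ A)).symm.imp (fun hzA => ⟨hzA, hbV hz⟩) fun hzA => ⟨hzA, hz⟩
  · intro h
    by_contra hn
    obtain ⟨b, hb, hbV, hbA⟩ := hA.compl.exists_basis_isMeagre_diff hV hn
    refine h b hb hbV (hbA.mono fun z hz => ?_)
    exact ⟨hz.2, fun hzA => hzA hz.1⟩

/-- The category quantifier preserves measurability. -/
theorem MeasurableSet.setOf_isMeagre_section {X Y : Type*} [MeasurableSpace X]
    [TopologicalSpace Y] [SecondCountableTopology Y] [BaireSpace Y] [MeasurableSpace Y]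
    [BorelSpace Y] {S : Set (X × Y)} (hS : MeasurableSet S) {V : Set Y} (hV : IsOpen V) :
    MeasurableSet {x | IsMeagre (Prod.mk x ⁻¹' S ∩ V)} := by
  -- All open `V` are treated at once, because complementation replaces `V` by the basic sets inside
  -- it.
  let M : MeasurableSpace (X × Y) :=
    { MeasurableSet' := fun S => (∀ x, BaireMeasurableSet (Prod.mk x ⁻¹' S)) ∧
        ∀ V, IsOpen V → MeasurableSet {x | IsMeagre (Prod.mk x ⁻¹' S ∩ V)}
      measurableSet_empty := by
        exact ⟨fun _ => isOpen_empty.baireMeasurableSet, fun V _ => .const (IsMeagre (∅ ∩ V))⟩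
      measurableSet_compl := fun S hS => by
        refine ⟨fun x => (hS.1 x).compl, fun V hV => ?_⟩
        have : {x | IsMeagre (Prod.mk x ⁻¹' Sᶜ ∩ V)} =
            ⋂ b ∈ countableBasis Y, ⋂ _ : b ⊆ V, {x | IsMeagre (Prod.mk x ⁻¹' S ∩ b)}ᶜ := by
          ext x
          simpa using (hS.1 x).isMeagre_compl_inter_iff hV
        rw [this]
        exact .biInter (countable_countableBasis Y) fun b hb =>
          .iInter fun _ => (hS.2 b (isOpen_of_mem_countableBasis hb)).compl
      measurableSet_iUnion := fun S hS => by
        refine ⟨fun x => ?_, fun V hV => ?_⟩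
        · rw [preimage_iUnion]
          exact .iUnion fun n => (hS n).1 x
        · have : {x | IsMeagre (Prod.mk x ⁻¹' (⋃ n, S n) ∩ V)} =
              ⋂ n, {x | IsMeagre (Prod.mk x ⁻¹' S n ∩ V)} := by
            ext x
            simp only [preimage_iUnion, iUnion_inter, mem_ofPred_eq, mem_iInter]
            exact ⟨fun h n => h.mono (subset_iUnion (fun n => Prod.mk x ⁻¹' S n ∩ V) n),
              isMeagre_iUnion⟩
          rw [this]
          exact .iInter fun n => (hS n).2 V hV }
  have hM : Prod.instMeasurableSpace ≤ M := by
    refine sup_le ?_ ?_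
    · rintro _ ⟨A, hA, rfl⟩
      have hsec (x : X) : Prod.mk x ⁻¹' (Prod.fst ⁻¹' A : Set (X × Y)) = {_y | x ∈ A} := rfl
      refine ⟨fun x => ?_, fun V hV => ?_⟩
      · rw [hsec]
        exact isOpen_const.baireMeasurableSet
      · by_cases hVm : IsMeagre V
        · convert MeasurableSet.univ
          exact eq_univ_of_forall fun x => hVm.mono inter_subset_right
        · convert hA.compl
          ext x
          by_cases hx : x ∈ A <;> simp [hsec, hx, hVm, IsMeagre.empty]
    · rw [BorelSpace.measurable_eq (α := Y), borel, MeasurableSpace.comap_generateFrom]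
      refine MeasurableSpace.generateFrom_le ?_
      rintro _ ⟨U, hU, rfl⟩
      exact ⟨fun x => IsOpen.baireMeasurableSet hU, fun V hV => .const (IsMeagre (U ∩ V))⟩
  exact (hM S hS).2 V hV

/-- The points at which a set is locally nonmeagre. -/
def locallyNonmeagre {α : Type*} [TopologicalSpace α] (A : Set α) : Set α :=
  {z | ∀ U, IsOpen U → z ∈ U → ¬ IsMeagre (A ∩ U)}

theorem isClosed_locallyNonmeagre {α : Type*} [TopologicalSpace α] (A : Set α) :
    IsClosed (locallyNonmeagre A) := by
  refine ⟨isOpen_iff_forall_mem_open.2 fun z hz => ?_⟩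
  simp only [locallyNonmeagre, mem_compl_iff, mem_ofPred_eq, not_forall, not_not] at hz
  obtain ⟨U, hU, hzU, hAU⟩ := hz
  exact ⟨U, fun y hy h => h U hU hy hAU, hU, hzU⟩

/-- Points of `A` that are not locally nonmeagre are covered by countably many basic sets in which
`A` is meagre. -/
theorem locallyNonmeagre_inter_nonempty_iff {α : Type*} [TopologicalSpace α]
    [SecondCountableTopology α] (A : Set α) {V : Set α} (hV : IsOpen V) :
    (locallyNonmeagre A ∩ V).Nonempty ↔ ¬ IsMeagre (A ∩ V) := by
  constructor
  · rintro ⟨z, hz, hzV⟩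
    exact hz V hV hzV
  · intro h
    by_contra! hne
    apply h
    let T : Set (Set α) := {b ∈ countableBasis α | IsMeagre (A ∩ b)}
    have : Countable T := ((countable_countableBasis α).mono (sep_subset _ _)).to_subtype
    refine (isMeagre_iUnion fun b : T => b.2.2).mono fun z hz => ?_
    have hzD : z ∉ locallyNonmeagre A := fun hzD =>
      notMem_empty z (hne.subset ⟨hzD, hz.2⟩)
    simp only [locallyNonmeagre, mem_ofPred_eq, not_forall, not_not] at hzD
    obtain ⟨U, hU, hzU, hAU⟩ := hzD
    obtain ⟨b, hb, hzb, hbU⟩ := (isBasis_countableBasis α).exists_subset_of_mem_open hzU hU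
    exact mem_iUnion.2 ⟨⟨b, hb, hAU.mono (inter_subset_inter_right _ hbU)⟩, hz.1, hzb⟩

/-- Otherwise `A \ B` is comeagre in some basic `b`; then `B`, and by hypothesis `A`, is meagre in
`b`, against the Baire property of the space. -/
theorem isMeagre_diff_of_locallyNonmeagre_eq {α : Type*} [TopologicalSpace α]
    [SecondCountableTopology α] [BaireSpace α] {A B : Set α} (hA : BaireMeasurableSet A)
    (hB : BaireMeasurableSet B) (h : locallyNonmeagre A = locallyNonmeagre B) :
    IsMeagre (A \ B) := by
  by_contra hn
  rw [← inter_univ (A \ B)] at hn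
  obtain ⟨b, hb, -, hbAB⟩ := (hA.diff hB).exists_basis_isMeagre_diff isOpen_univ hn
  have hbo := isOpen_of_mem_countableBasis hb
  have hBb : IsMeagre (B ∩ b) := by
    refine hbAB.mono fun z hz => ?_
    exact ⟨hz.2, fun hz' => hz'.2 hz.1⟩
  have hAb : IsMeagre (A ∩ b) := by
    by_contra hAb
    rw [← locallyNonmeagre_inter_nonempty_iff A hbo, h,
      locallyNonmeagre_inter_nonempty_iff B hbo] at hAb
    exact hAb hBb
  refine not_isMeagre_of_isOpen hbo (nonempty_of_mem_countableBasis hb)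
    ((hAb.union hbAB).mono fun z hz => ?_)
  by_cases hzA : z ∈ A
  · exact .inl ⟨hzA, hz⟩
  · exact .inr ⟨hz, fun hz' => hzA hz'.1⟩

theorem residualEq_of_locallyNonmeagre_eq {α : Type*} [TopologicalSpace α]
    [SecondCountableTopology α] [BaireSpace α] {A B : Set α} (hA : BaireMeasurableSet A)
    (hB : BaireMeasurableSet B) (h : locallyNonmeagre A = locallyNonmeagre B) : A =ᵇ B := by
  refine eventuallyEq_set.2 ?_
  have h1 := isMeagre_diff_of_locallyNonmeagre_eq hA hB h
  have h2 := isMeagre_diff_of_locallyNonmeagre_eq hB hA h.symm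
  filter_upwards [h1, h2] with z hz1 hz2
  simp only [mem_compl_iff, Set.mem_sdiff, not_and, not_not] at hz1 hz2
  exact ⟨hz1, hz2⟩

theorem image_locallyNonmeagre_subset {α : Type u} {β : Type v} [TopologicalSpace α]
    [TopologicalSpace β] (e : α ≃ₜ β) (A : Set α) :
    e '' locallyNonmeagre A ⊆ locallyNonmeagre (e '' A) := by
  rintro _ ⟨z, hz, rfl⟩ U hU hzU hm
  refine hz (e ⁻¹' U) (hU.preimage e.continuous) hzU ?_
  convert hm.preimage_of_isOpenMap e.continuous e.isOpenMap using 1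
  rw [preimage_inter, e.injective.preimage_image]

theorem locallyNonmeagre_image {α : Type u} {β : Type v} [TopologicalSpace α]
    [TopologicalSpace β] (e : α ≃ₜ β) (A : Set α) :
    locallyNonmeagre (e '' A) = e '' locallyNonmeagre A := by
  refine Subset.antisymm (fun z hz => ?_) (image_locallyNonmeagre_subset e A)
  have h := image_locallyNonmeagre_subset e.symm (e '' A) (mem_image_of_mem _ hz)
  rw [← image_comp, e.symm_comp_self, image_id] at h
  exact ⟨_, h, e.apply_symm_apply z⟩

end Category

/-! ### The equivariant embedding by orbit traces. -/

namespace EffrosSpace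

open Set Filter Topology

variable {G : Type u} [Group G] [TopologicalSpace G] [IsTopologicalGroup G]

/-- The closed set of those `g` near which `g⁻¹ • x` lies in `A` nonmeagrely often. -/
def orbitTrace (G : Type u) [Group G] [TopologicalSpace G] {X : Type v} [MulAction G X]
    (A : Set X) (x : X) : EffrosSpace G :=
  (⟨locallyNonmeagre {g : G | g⁻¹ • x ∈ A}, isClosed_locallyNonmeagre _⟩ :
    TopologicalSpace.Closeds G)

/-- The inverse in `g⁻¹ • x ∈ A` makes moving `x` a left translation of the set of such `g`. -/
theorem orbitTrace_smul {X : Type v} [MulAction G X] (A : Set X) (g : G) (x : X) :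
    orbitTrace G A (g • x) = g • orbitTrace G A x := by
  refine EffrosSpace.ext ?_
  have h : {k : G | k⁻¹ • g • x ∈ A} = Homeomorph.mulLeft g '' {k : G | k⁻¹ • x ∈ A} := by
    ext k
    simp [smul_smul]
  rw [toSet_smul]
  exact (congrArg locallyNonmeagre h).trans (locallyNonmeagre_image _ _)

theorem measurable_orbitTrace [SecondCountableTopology G] [BaireSpace G] [MeasurableSpace G]
    [BorelSpace G] {X : Type v} [MeasurableSpace X] [MulAction G X]
    (hact : Measurable fun p : G × X => p.1 • p.2) {A : Set X} (hA : MeasurableSet A) :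
    Measurable (orbitTrace G A) := by
  refine measurable_generateFrom ?_
  rintro _ ⟨V, hV, rfl⟩
  have hm : Measurable fun p : X × G => p.2⁻¹ • p.1 :=
    hact.comp (measurable_snd.inv.prodMk measurable_fst)
  convert ((hm hA).setOf_isMeagre_section hV).compl
  ext x
  exact locallyNonmeagre_inter_nonempty_iff _ hV

theorem exists_isBorelGEmbedding [SecondCountableTopology G] [BaireSpace G] [MeasurableSpace G]
    [BorelSpace G] {X : Type v} [MeasurableSpace X] [MeasurableSpace.CountablySeparated X]
    [MulAction G X] (hact : Measurable fun p : G × X => p.1 • p.2) :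
    ∃ π : X → ℕ → EffrosSpace G, IsBorelGEmbedding G π := by
  obtain ⟨A, hA, hsep⟩ := exists_seq_separating X (p := MeasurableSet) .univ univ
  refine ⟨fun x n => orbitTrace G (A n) x,
    measurable_pi_iff.2 fun n => measurable_orbitTrace hact (hA n), fun x y hxy => ?_,
    fun g x => funext fun n => orbitTrace_smul (A n) g x⟩
  have hB (n : ℕ) (x : X) : BaireMeasurableSet {g : G | g⁻¹ • x ∈ A n} :=
    MeasurableSet.baireMeasurableSet
      ((hact.comp (measurable_inv.prodMk measurable_const)) (hA n))
  have hev : ∀ᶠ g : G in residual G, ∀ n, g⁻¹ • x ∈ A n ↔ g⁻¹ • y ∈ A n :=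
    eventually_countable_forall.2 fun n => eventuallyEq_set.1 <|
      residualEq_of_locallyNonmeagre_eq (hB n x) (hB n y) (congrArg toSet (congrFun hxy n))
  -- A residual set in a nonempty Baire space is nonempty, so one `g` works for all `n`.
  obtain ⟨g, hg⟩ := (dense_of_mem_residual hev).nonempty
  exact smul_left_cancel g⁻¹ (hsep _ (mem_univ _) _ (mem_univ _) hg)

end EffrosSpace

theorem theorem2p1 (G : Type u) [Group G] [TopologicalSpace G] [IsTopologicalGroup G]
    [PolishSpace G] [MeasurableSpace G] [BorelSpace G] :
    IsUniversalBorelGSpace.{u, v, u} G (ℕ → EffrosSpace G) ∧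
      ∃ τ : TopologicalSpace (ℕ → EffrosSpace G),
        @BorelSpace (ℕ → EffrosSpace G) τ MeasurableSpace.pi ∧
          IsPolishGSpace G (ℕ → EffrosSpace G) τ := by
  obtain ⟨σ, hσ, hpolish, hcont⟩ := EffrosSpace.exists_isPolishGSpace G
  have hact : Continuous fun p : G × (ℕ → EffrosSpace G) => p.1 • p.2 :=
    continuous_pi fun n => hcont.comp
      (continuous_fst.prodMk ((continuous_apply n).comp continuous_snd))
  -- The Polish topology `σ` also supplies the standard Borel structure of the product.
  refine ⟨⟨⟨inferInstance, hact.measurable⟩, fun X _ _ hX => ?_⟩,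
    Pi.topologicalSpace, Pi.borelSpace, inferInstance, hact⟩
  have := hX.1
  exact EffrosSpace.exists_isBorelGEmbedding hX.2
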